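/- Setting. All groups $G$ below are real analytic Banach--Lie groups, $G^\circ$ is the identity component of $G$, and $\exp$ its exponential map. A (real) Banach--Lie superalgebra is a real Lie superalgebra $\mathfrak g=\mathfrak g_{\bar 0}\oplus\mathfrak g_{\bar 1}$ that is a Banach space with $\|[x,y]\|\le\|x\|\,\|y\|$ and with $\mathfrak g_{\bar 0},\mathfrak g_{\bar 1}$ closed. A Banach--Lie supergroup is a pair $(G,\mathfrak g)$ of a Banach--Lie group and a Banach--Lie superalgebra with $\mathfrak g_{\bar 0}=\mathrm{Lie}(G)$, together with an analytic homomorphism $\mathrm{Ad}$ from $G$ to the group of continuous even automorphisms of $\mathfrak g$ such that $\mathsf d_e\mathrm{Ad}(x)y=[x,y]$ for $x\in\mathfrak g_{\bar 0}$, $y\in\mathfrak g$. A unitary representation $(\pi,\mathscr H)$ of $G$ is a homomorphism from $G$ to the unitary group of a complex Hilbert space $\mathscr H$ with continuous orbit maps $\pi^v(g)=\pi(g)v$; $\mathscr H^\infty$ is the space of all $v$ with $\pi^v$ smooth; and for $x\in\mathrm{Lie}(G)$, $\mathsf d\pi(x)$ is the skew-adjoint generator of $t\mapsto\pi(\exp(tx))$.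 A pre-representation of $(G,\mathfrak g)$ is a 4-tuple $(\pi,\mathscr H,\mathscr B,\rho^{\mathscr B})$ such that: (i) $(\pi,\mathscr H)$ is a unitary representation of $G$ on a $\mathbb Z_2$-graded Hilbert space $\mathscr H=\mathscr H_{\bar 0}\oplus\mathscr H_{\bar 1}$ (orthogonal sum), and every $\pi(g)$ is even; (ii) $\mathscr B\subseteq\mathscr H$ is a dense $\mathbb Z_2$-graded subspace with $\mathscr B\subseteq\bigcap_{x\in\mathfrak g_{\bar 0}}\mathcal D(\mathsf d\pi(x))$; (iii) $\rho^{\mathscr B}:\mathfrak g\to\mathrm{End}_{\mathbb C}(\mathscr B)$ is a representation of the Lie superalgebra $\mathfrak g$ (no continuity is assumed); (iv) for $x\in\mathfrak g_{\bar 0}$, $\rho^{\mathscr B}(x)=\mathsf d\pi(x)|_{\mathscr B}$ and $\rho^{\mathscr B}(x)$ is essentially skew-adjoint; (v) for $x\in\mathfrak g_{\bar 1}$, $e^{-\pi i/4}\rho^{\mathscr B}(x)$ is symmetric; (vi) every element of $G/G^\circ$ has a representative $g\in G$ with $\pi(g)^{-1}\mathscr B\subseteq\mathscr B$ and $\pi(g)\rho^{\mathscr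 B}(x)\pi(g)^{-1}=\rho^{\mathscr B}(\mathrm{Ad}(g)x)$ on $\mathscr B$ for all $x\in\mathfrak g_{\bar 1}$. Statement. Let $(\pi,\mathscr H,\mathscr B,\rho^{\mathscr B})$ be a pre-representation of a Banach--Lie supergroup $(G,\mathfrak g)$. For every homogeneous $a\in\mathfrak g$ the operator $\rho^{\mathscr B}(a)$ is closable and $\mathscr H^\infty\subseteq\mathcal D(\overline{\rho^{\mathscr B}(a)})$. Consequently, for $x\in\mathfrak g^{\mathbb C}=\mathfrak g\otimes_{\mathbb R}\mathbb C$, written as $x=(a_{\bar 0}+ib_{\bar 0})+(a_{\bar 1}+ib_{\bar 1})$ with $a_{\bar 0},b_{\bar 0}\in\mathfrak g_{\bar 0}$ and $a_{\bar 1},b_{\bar 1}\in\mathfrak g_{\bar 1}$, the formula $$\tilde\rho^{\mathscr B}(x)v=\overline{\rho^{\mathscr B}(a_{\bar 0})}v+i\,\overline{\rho^{\mathscr B}(b_{\bar 0})}v+\overline{\rho^{\mathscr B}(a_{\bar 1})}v+i\,\overline{\rho^{\mathscr B}(b_{\bar 1})}v$$ defines a linear operator $\tilde\rho^{\mathscr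 B}(x)$ with domain $\mathscr H^\infty$. Moreover $\tilde\rho^{\mathscr B}(x)\mathscr H^\infty\subseteq\mathscr H^\infty$ for every $x\in\mathfrak g^{\mathbb C}$. -/

import Mathlib

open scoped Manifold ContDiff TensorProduct

noncomputable section

/-! ### Banach--Lie groups: exponential curves -/

section Exponential

variable {E : Type*} [NormedAddCommGroup E] [NormedSpace ℝ E]
  {G : Type*} [TopologicalSpace G] [ChartedSpace E G] [Group G]

/-- `γ` is the exponential curve `t ↦ exp (t X)`: the global integral curve, starting at the
identity, of the left-invariant vector field determined by `X ∈ Lie(G)`. -/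
def IsExpCurve (X : GroupLieAlgebra 𝓘(ℝ, E) G) (γ : ℝ → G) : Prop :=
  γ 0 = 1 ∧ IsMIntegralCurve (I := 𝓘(ℝ, E)) γ (mulInvariantVectorField X)

variable [LieGroup 𝓘(ℝ, E) ω G]

theorem contMDiff_one_mulInvariantVectorField (X : GroupLieAlgebra 𝓘(ℝ, E) G) :
    ContMDiff 𝓘(ℝ, E) 𝓘(ℝ, E).tangent 1
      (fun g : G => (⟨g, mulInvariantVectorField X g⟩ : TangentBundle 𝓘(ℝ, E) G)) :=
  (contMDiff_mulInvariantVectorField X).of_le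
    (le_trans (by norm_num) (le_minSmoothness (𝕜 := ℝ) (n := 2)))

theorem mfderiv_mul_left_mulInvariantVectorField (X : GroupLieAlgebra 𝓘(ℝ, E) G) (g h : G) :
    mfderiv 𝓘(ℝ, E) 𝓘(ℝ, E) (g * ·) h (mulInvariantVectorField X h)
      = mulInvariantVectorField X (g * h) := by
  have hd : ∀ a b : G, MDifferentiableAt 𝓘(ℝ, E) 𝓘(ℝ, E) (a * ·) b := fun a b =>
    (contMDiff_mul_left (I := 𝓘(ℝ, E)) (n := ω) (a := a)).contMDiffAt.mdifferentiableAt (by simp)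
  have hc : (fun x : G => g * h * x) = (fun x => g * x) ∘ (fun x => h * x) := by
    ext x; simp [mul_assoc]
  unfold mulInvariantVectorField
  have h1 := mfderiv_comp (I' := 𝓘(ℝ, E)) (1 : G) (hd g (h * 1)) (hd h 1)
  rw [hc, h1]
  have h2 : ∀ k : G, k = h → ∀ w : E,
      (mfderiv 𝓘(ℝ, E) 𝓘(ℝ, E) (g * ·) h : E →L[ℝ] E) w
        = (mfderiv 𝓘(ℝ, E) 𝓘(ℝ, E) (g * ·) k : E →L[ℝ] E) w := by
    rintro k rfl w; rfl
  exact h2 (h * 1) (mul_one h) _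

theorem IsExpCurve.unique {X : GroupLieAlgebra 𝓘(ℝ, E) G} {γ γ' : ℝ → G}
    (h : IsExpCurve X γ) (h' : IsExpCurve X γ') : γ = γ' := by
  have : IsTopologicalGroup G := topologicalGroup_of_lieGroup 𝓘(ℝ, E) ω
  have : T1Space G := ChartedSpace.t1Space E G
  have : IsManifold 𝓘(ℝ, E) 1 G := IsManifold.of_le (n := ω) le_top
  exact isMIntegralCurve_Ioo_eq_of_contMDiff_boundaryless (t₀ := 0)
    (contMDiff_one_mulInvariantVectorField X) h.2 h'.2 (h.1.trans h'.1.symm)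

variable [CompleteSpace E]

theorem exists_isExpCurve (X : GroupLieAlgebra 𝓘(ℝ, E) G) : ∃ γ : ℝ → G, IsExpCurve X γ := by
  have : IsTopologicalGroup G := topologicalGroup_of_lieGroup 𝓘(ℝ, E) ω
  have : T1Space G := ChartedSpace.t1Space E G
  have : IsManifold 𝓘(ℝ, E) 1 G := IsManifold.of_le (n := ω) le_top
  have hv := contMDiff_one_mulInvariantVectorField X
  obtain ⟨γ, h0, hγ⟩ :=
    exists_isMIntegralCurveAt_of_contMDiffAt_boundaryless (t₀ := 0) (hv.contMDiffAt (x := 1))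
  obtain ⟨ε, hε, hγ⟩ := isMIntegralCurveAt_iff'.1 hγ
  refine exists_isMIntegralCurve_of_isMIntegralCurveOn hv hε (fun g => ⟨fun t => g * γ t, ?_, ?_⟩) 1
  · simp [h0]
  · intro t ht
    have hb : Metric.ball (0 : ℝ) ε = Set.Ioo (-ε) ε := by simp [Real.ball_eq_Ioo]
    rw [hb] at hγ
    have h1 := hγ t ht
    have h2 : HasMFDerivAt 𝓘(ℝ, E) 𝓘(ℝ, E) (g * ·) (γ t)
        (mfderiv 𝓘(ℝ, E) 𝓘(ℝ, E) (g * ·) (γ t)) :=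
      ((contMDiff_mul_left (I := 𝓘(ℝ, E)) (n := ω) (a := g)).contMDiffAt.mdifferentiableAt
        (by simp)).hasMFDerivAt
    have h3 := h2.comp_hasMFDerivWithinAt t h1
    have h4 : ∀ (D : E →L[ℝ] E) (v : E), D.comp ((1 : ℝ →L[ℝ] ℝ).smulRight v)
        = (1 : ℝ →L[ℝ] ℝ).smulRight (D v) := fun D v => by ext; simp
    rw [← mfderiv_mul_left_mulInvariantVectorField X g (γ t)]
    exact h3.congr_mfderiv (h4 _ _)

/-- The curve `t ↦ exp (t X)`. -/
def expCurve (X : GroupLieAlgebra 𝓘(ℝ, E) G) : ℝ → G := (exists_isExpCurve X).choose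

theorem isExpCurve_expCurve (X : GroupLieAlgebra 𝓘(ℝ, E) G) : IsExpCurve X (expCurve X) :=
  (exists_isExpCurve X).choose_spec

end Exponential

/-! ### Unbounded operators -/

section Operators

variable {H : Type*} [NormedAddCommGroup H] [InnerProductSpace ℂ H]

/-- The infinitesimal generator of `t ↦ U t`: its domain consists of all `v` for which `t ↦ U t v`
is differentiable at `0`, and its value at such a `v` is that derivative. -/
def infGenerator (U : ℝ → H ≃ₗᵢ[ℂ] H) : H →ₗ.[ℂ] H where
  domain :=
    { carrier := {v | DifferentiableAt ℝ (fun t => U t v) 0}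
      add_mem' := fun {a b} ha hb => by
        simpa [Pi.add_def] using DifferentiableAt.add (f := fun t => U t a) (g := fun t => U t b) ha hb
      zero_mem' := by simp
      smul_mem' := fun c a ha => by
        simpa [Pi.smul_def] using DifferentiableAt.const_smul (f := fun t => U t a) ha c }
  toFun :=
    { toFun := fun v => deriv (fun t => U t (v : H)) 0
      map_add' := fun a b => by
        simpa [Pi.add_def] using deriv_add (f := fun t => U t (a : H)) (g := fun t => U t (b : H)) a.2 b.2
      map_smul' := fun c a => by
        simpa [Pi.smul_def] using deriv_const_smul (f := fun t => U t (a : H)) c a.2 }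

/-- A densely defined closable operator is essentially skew-adjoint if its closure is
skew-adjoint. -/
def IsEssentiallySkewAdjoint [CompleteSpace H] (A : H →ₗ.[ℂ] H) : Prop :=
  Dense (A.domain : Set H) ∧ A.IsClosable ∧ A.closure.adjoint = -A.closure

/-- Symmetric operators (on their domain). -/
def IsSymmetricOperator (A : H →ₗ.[ℂ] H) : Prop :=
  ∀ v w : A.domain, inner ℂ (A v) (w : H) = inner ℂ (v : H) (A w)

/-- A `ℤ/2`-grading of a Hilbert space as an orthogonal direct sum (both summands are then
automatically closed). -/
structure HilbertGrading (H : Type*) [NormedAddCommGroup H] [InnerProductSpace ℂ H] where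
  part : ZMod 2 → Submodule ℂ H
  isCompl : IsCompl (part 0) (part 1)
  orthogonal : part 0 ⟂ part 1

end Operators

/-! ### Banach--Lie superalgebras and supergroups -/

/-- The Koszul sign `(-1) ^ (i j)` for parities `i`, `j`. -/
def superSign (i j : ZMod 2) : ℝ := (-1) ^ (i.val * j.val)

/-- A real Banach--Lie superalgebra structure on the Banach space `𝔤`. -/
structure BanachLieSuperalgebra (𝔤 : Type*) [NormedAddCommGroup 𝔤] [NormedSpace ℝ 𝔤] where
  part : ZMod 2 → Submodule ℝ 𝔤
  isCompl : IsCompl (part 0) (part 1)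
  isClosed_part : ∀ i, IsClosed (part i : Set 𝔤)
  bracket : 𝔤 →ₗ[ℝ] 𝔤 →ₗ[ℝ] 𝔤
  bracket_mem : ∀ i j, ∀ x ∈ part i, ∀ y ∈ part j, bracket x y ∈ part (i + j)
  bracket_skew : ∀ i j, ∀ x ∈ part i, ∀ y ∈ part j,
    bracket x y = -(superSign i j • bracket y x)
  bracket_jacobi : ∀ i j, ∀ x ∈ part i, ∀ y ∈ part j, ∀ z,
    bracket x (bracket y z) = bracket (bracket x y) z + superSign i j • bracket y (bracket x z)
  norm_bracket_le : ∀ x y, ‖bracket x y‖ ≤ ‖x‖ * ‖y‖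

/-- The differential at `1` of a map from a Lie group to a normed space `V`, with the tangent spaces
of `V` identified with `V`. -/
def differentialAtOne {E : Type*} [NormedAddCommGroup E] [NormedSpace ℝ E]
    {G : Type*} [TopologicalSpace G] [ChartedSpace E G] [Group G]
    {V : Type*} [NormedAddCommGroup V] [NormedSpace ℝ V]
    (F : G → V) (X : GroupLieAlgebra 𝓘(ℝ, E) G) : V :=
  mfderiv 𝓘(ℝ, E) 𝓘(ℝ, V) F 1 X

/-- A Banach--Lie supergroup `(G, 𝔤)`: `G` is a real analytic Banach--Lie group (modelled on `E`),
`𝔤` a real Banach--Lie superalgebra, the even part of `𝔤` is identified with `Lie(G)` as a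
topological Lie algebra through `lieEquiv`, and `Ad` is an analytic homomorphism from `G` to the
group of continuous even automorphisms of `𝔤` whose differential at `1` is `ad`. -/
structure BanachLieSupergroup
    (E : Type*) [NormedAddCommGroup E] [NormedSpace ℝ E] [CompleteSpace E]
    (G : Type*) [TopologicalSpace G] [ChartedSpace E G] [Group G] [LieGroup 𝓘(ℝ, E) ω G]
    (𝔤 : Type*) [NormedAddCommGroup 𝔤] [NormedSpace ℝ 𝔤] where
  alg : BanachLieSuperalgebra 𝔤
  lieEquiv : GroupLieAlgebra 𝓘(ℝ, E) G ≃L[ℝ] alg.part 0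
  lieEquiv_lie : ∀ X Y : GroupLieAlgebra 𝓘(ℝ, E) G,
    (lieEquiv ⁅X, Y⁆ : 𝔤) = alg.bracket (lieEquiv X) (lieEquiv Y)
  Ad : G →* (𝔤 ≃L[ℝ] 𝔤)
  Ad_mem : ∀ g i, ∀ x ∈ alg.part i, Ad g x ∈ alg.part i
  Ad_bracket : ∀ g x y, Ad g (alg.bracket x y) = alg.bracket (Ad g x) (Ad g y)
  Ad_analytic : ContMDiff 𝓘(ℝ, E) 𝓘(ℝ, 𝔤 →L[ℝ] 𝔤) ω (fun g => (Ad g : 𝔤 →L[ℝ] 𝔤))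
  Ad_deriv : ∀ (X : GroupLieAlgebra 𝓘(ℝ, E) G) (y : 𝔤),
    differentialAtOne (fun g => (Ad g : 𝔤 →L[ℝ] 𝔤)) X y = alg.bracket (lieEquiv X) y

/-! ### Unitary representations of Banach--Lie groups -/

/-- A unitary representation of the topological group `G` on `H`. -/
structure UnitaryRep (G : Type*) [TopologicalSpace G] [Group G]
    (H : Type*) [NormedAddCommGroup H] [InnerProductSpace ℂ H] where
  toHom : G →* (H ≃ₗᵢ[ℂ] H)
  continuous_orbit : ∀ v : H, Continuous (fun g => toHom g v)

namespace UnitaryRep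

variable {E : Type*} [NormedAddCommGroup E] [NormedSpace ℝ E]
  {G : Type*} [TopologicalSpace G] [ChartedSpace E G] [Group G]
  {H : Type*} [NormedAddCommGroup H] [InnerProductSpace ℂ H]

/-- `dπ(X)`: the generator of the unitary one-parameter group `t ↦ π(exp (t X))`. -/
def dpi [LieGroup 𝓘(ℝ, E) ω G] [CompleteSpace E] (π : UnitaryRep G H)
    (X : GroupLieAlgebra 𝓘(ℝ, E) G) : H →ₗ.[ℂ] H :=
  infGenerator (fun t => π.toHom (expCurve X t))

variable (E) in
/-- The space `H^∞` of smooth vectors: those whose orbit map `G → H` is smooth. -/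
def smoothVectors (π : UnitaryRep G H) : Submodule ℂ H where
  carrier := {v | ContMDiff 𝓘(ℝ, E) 𝓘(ℝ, H) ∞ (fun g : G => π.toHom g v)}
  add_mem' := fun {a b} ha hb => by
    simpa [Pi.add_def] using ContMDiff.add (f := fun g => π.toHom g a) (g := fun g => π.toHom g b) ha hb
  zero_mem' := by simpa using contMDiff_const
  smul_mem' := fun c a ha => by
    have h : ContMDiff 𝓘(ℝ, H) 𝓘(ℝ, H) ∞ (fun v : H => c • v) :=
      (contDiff_const_smul c).contMDiff
    simpa using! h.comp (f := fun g => π.toHom g a) ha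

end UnitaryRep

/-! ### Pre-representations -/

section PreRepresentation

variable {E : Type*} [NormedAddCommGroup E] [NormedSpace ℝ E] [CompleteSpace E]
  {G : Type*} [TopologicalSpace G] [ChartedSpace E G] [Group G] [LieGroup 𝓘(ℝ, E) ω G]
  {𝔤 : Type*} [NormedAddCommGroup 𝔤] [NormedSpace ℝ 𝔤]
  {H : Type*} [NormedAddCommGroup H] [InnerProductSpace ℂ H] [CompleteSpace H]

/-- An endomorphism of the subspace `B`, as an unbounded operator on `H` with domain `B`. -/
def opOfEnd (B : Submodule ℂ H) (T : Module.End ℂ B) : H →ₗ.[ℂ] H :=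
  ⟨B, B.subtype ∘ₗ T⟩

/-- A pre-representation `(π, H, B, ρ)` of the Banach--Lie supergroup `S = (G, 𝔤)` on the
`ℤ/2`-graded Hilbert space `H`. In `rho_even`, the relation `≤` means extension of operators, so
it says that `B ⊆ D(dπ(X))` and that `ρ(X)` is the restriction of `dπ(X)` to `B`. -/
structure PreRepresentation (S : BanachLieSupergroup E G 𝔤) (Γ : HilbertGrading H) where
  π : UnitaryRep G H
  π_even : ∀ g i, ∀ v ∈ Γ.part i, π.toHom g v ∈ Γ.part i
  B : Submodule ℂ H
  dense_B : Dense (B : Set H)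
  graded_B : B ⊓ Γ.part 0 ⊔ B ⊓ Γ.part 1 = B
  rho : 𝔤 →ₗ[ℝ] Module.End ℂ B
  rho_mem : ∀ i j, ∀ x ∈ S.alg.part i, ∀ v : B, (v : H) ∈ Γ.part j →
    (rho x v : H) ∈ Γ.part (i + j)
  rho_bracket : ∀ i j, ∀ x ∈ S.alg.part i, ∀ y ∈ S.alg.part j,
    rho (S.alg.bracket x y) = rho x * rho y - superSign i j • (rho y * rho x)
  rho_even : ∀ X : GroupLieAlgebra 𝓘(ℝ, E) G, opOfEnd B (rho (S.lieEquiv X)) ≤ π.dpi X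
  rho_skew : ∀ x ∈ S.alg.part 0, IsEssentiallySkewAdjoint (opOfEnd B (rho x))
  rho_odd : ∀ x ∈ S.alg.part 1,
    IsSymmetricOperator (Complex.exp (-(Real.pi * Complex.I / 4)) • opOfEnd B (rho x))
  conj : ∀ h : G, ∃ g : G, h⁻¹ * g ∈ connectedComponent (1 : G) ∧
    ∃ hB : ∀ v ∈ B, π.toHom g⁻¹ v ∈ B, ∀ x ∈ S.alg.part 1, ∀ v : B,
      π.toHom g (rho x ⟨π.toHom g⁻¹ v, hB v v.2⟩) = (rho (S.Ad g x) v : H)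

/-- Real part of an element of the complexification: `z ⊗ a ↦ Re(z) a`. -/
def complexificationRe (𝔤 : Type*) [AddCommGroup 𝔤] [Module ℝ 𝔤] : ℂ ⊗[ℝ] 𝔤 →ₗ[ℝ] 𝔤 :=
  TensorProduct.lift (LinearMap.lsmul ℝ 𝔤 ∘ₗ Complex.reLm)

/-- Imaginary part of an element of the complexification: `z ⊗ a ↦ Im(z) a`. -/
def complexificationIm (𝔤 : Type*) [AddCommGroup 𝔤] [Module ℝ 𝔤] : ℂ ⊗[ℝ] 𝔤 →ₗ[ℝ] 𝔤 :=
  TensorProduct.lift (LinearMap.lsmul ℝ 𝔤 ∘ₗ Complex.imLm)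

namespace BanachLieSuperalgebra

/-- The even component of an element of a superalgebra. -/
def even (A : BanachLieSuperalgebra 𝔤) : 𝔤 →ₗ[ℝ] 𝔤 :=
  (A.part 0).subtype ∘ₗ (A.part 0).projectionOnto (A.part 1) A.isCompl

/-- The odd component of an element of a superalgebra. -/
def odd (A : BanachLieSuperalgebra 𝔤) : 𝔤 →ₗ[ℝ] 𝔤 :=
  (A.part 1).subtype ∘ₗ (A.part 1).projectionOnto (A.part 0) A.isCompl.symm

end BanachLieSuperalgebra

namespace PreRepresentation

variable {S : BanachLieSupergroup E G 𝔤} {Γ : HilbertGrading H}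

/-- `ρ(a)` as an unbounded operator on `H` with domain `B`. -/
def op (P : PreRepresentation S Γ) (a : 𝔤) : H →ₗ.[ℂ] H := opOfEnd P.B (P.rho a)

/-- The space `H^∞` of smooth vectors of the underlying representation of `G`. -/
def smooth (P : PreRepresentation S Γ) : Submodule ℂ H := P.π.smoothVectors E

/-- For `x = (a₀ + i b₀) + (a₁ + i b₁)` in the complexification, with `a₀, b₀` even and `a₁, b₁`
odd, the restriction to `H^∞` of the sum of the closures of `ρ(a₀)`, `i ρ(b₀)`, `ρ(a₁)`, `i ρ(b₁)`.
Sums of unbounded operators are defined on the intersection of the domains, and `domRestrict`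
intersects the domain with `H^∞`. -/
def rhoTilde (P : PreRepresentation S Γ) (x : ℂ ⊗[ℝ] 𝔤) : H →ₗ.[ℂ] H :=
  ((P.op (S.alg.even (complexificationRe 𝔤 x))).closure
    + Complex.I • (P.op (S.alg.even (complexificationIm 𝔤 x))).closure
    + (P.op (S.alg.odd (complexificationRe 𝔤 x))).closure
    + Complex.I • (P.op (S.alg.odd (complexificationIm 𝔤 x))).closure).domRestrict P.smooth

end PreRepresentation

end PreRepresentation

end

/-! For even elements, essential skew-adjointness forces the closure of ρ(X) to extend the generator
dπ(X). So smooth vectors lie in its domain, and dπ(X) preserves them because π(g)dπ(X)v is a partial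
derivative of the smooth map (g, h) ↦ π(gh)v.

For odd a, ρ(a) agrees with its formal adjoint up to a unimodular factor, hence is closable, and
ρ([a,a]) = 2ρ(a)² gives ‖ρ(a)v‖² ≤ ½‖v‖‖ρ([a,a])v‖ on B. The closure of ρ(a) is therefore defined
wherever that of the even operator ρ([a,a]) is, with the same bound (`exists_mem_clGraph_odd`). Once
v is normed together with X ↦ dπ(X)v, the map (a, v) ↦ ρ(a)v becomes bounded bilinear (`oddAction`
on `TangentPairs`), so g ↦ ρ(Ad(g)a)π(g)v is smooth for smooth v (`contMDiff_oddOrbit`).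

It remains to see that this map is g ↦ π(g)ρ(a)v near 1. Along exponential curves, its pairing with
π(g)u, u in B, has derivative zero by the bracket relation for [X, a]. The set of g where the
identity holds for all a and v is closed and stable under right multiplication by exponentials. Such
a set is a neighbourhood of 1 (`mem_nhds_one_of_mul_expCurve_mem`), by an Ekeland-type argument in a
chart that needs no local inverse of exp. An orbit map that is smooth near 1 is smooth everywhere.
-/

noncomputable section

open Filter Set
open scoped Topology

/-! ### Smoothness of maps into a closed subspace -/

section CodRestrict

universe u v

/-- The range of `ι` need not be complemented, so no projection is available. It is closed because
`V` is complete, and it contains the difference quotients, hence the values of the derivative. -/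
theorem LinearIsometry.hasFDerivAt_of_comp {E V F : Type*}
    [NormedAddCommGroup E] [NormedSpace ℝ E] [NormedAddCommGroup V] [NormedSpace ℝ V]
    [CompleteSpace V] [NormedAddCommGroup F] [NormedSpace ℝ F] (ι : V →ₗᵢ[ℝ] F) {f : E → V}
    {f' : E →L[ℝ] F} {x : E} (h : HasFDerivAt (fun y => ι (f y)) f' x) :
    ∃ g' : E →L[ℝ] V, ι.toContinuousLinearMap.comp g' = f' ∧ HasFDerivAt f g' x := by
  have hcl : IsClosed (range ι) := ι.isometry.isClosedEmbedding.isClosed_range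
  have hmem : ∀ e, ∃ w, ι w = f' e := by
    intro e
    have hl := (h.hasLineDerivAt e).tendsto_slope_zero
    refine hcl.mem_of_tendsto hl (Eventually.of_forall fun t => ⟨t⁻¹ • (f (x + t • e) - f x), ?_⟩)
    simp
  choose g hg using hmem
  let g' : E →ₗ[ℝ] V :=
    { toFun := g
      map_add' := fun a b => ι.injective (by simp [hg])
      map_smul' := fun c a => ι.injective (by simp [hg]) }
  have hbound : ∀ e, ‖g' e‖ ≤ ‖f'‖ * ‖e‖ := fun e => by
    rw [← ι.norm_map]
    change ‖ι (g e)‖ ≤ _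
    rw [hg]
    exact f'.le_opNorm e
  refine ⟨g'.mkContinuous _ hbound, ?_, ?_⟩
  · ext e
    exact hg e
  · rw [hasFDerivAt_iff_isLittleO] at h ⊢
    refine (h.norm_left.congr_left fun y => ?_).of_norm_left
    change ‖ι (f y) - ι (f x) - f' (y - x)‖ = ‖f y - f x - g (y - x)‖
    rw [← ι.norm_map (f y - f x - g (y - x)), map_sub ι, map_sub ι, hg]

/-- The isometry of spaces of continuous linear maps given by composition with an isometry. -/
def LinearIsometry.postcompCLM (E : Type*) {V F : Type*}
    [NormedAddCommGroup E] [NormedSpace ℝ E] [NormedAddCommGroup V] [NormedSpace ℝ V]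
    [NormedAddCommGroup F] [NormedSpace ℝ F] (ι : V →ₗᵢ[ℝ] F) : (E →L[ℝ] V) →ₗᵢ[ℝ] (E →L[ℝ] F) where
  toLinearMap := (ContinuousLinearMap.compL ℝ E V F ι.toContinuousLinearMap).toLinearMap
  norm_map' := fun _ => ι.norm_toContinuousLinearMap_comp

/-- In the induction the derivative takes values in `E →L[ℝ] V`, embedded by `postcompCLM`; the
universe of `V` and `F` must be stable under this step. -/
theorem LinearIsometry.contDiffAt_of_comp {E : Type u} {V F : Type (max u v)}
    [NormedAddCommGroup E] [NormedSpace ℝ E] [NormedAddCommGroup V] [NormedSpace ℝ V]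
    [CompleteSpace V] [NormedAddCommGroup F] [NormedSpace ℝ F] (ι : V →ₗᵢ[ℝ] F) {f : E → V}
    {x : E} {n : ℕ} (h : ContDiffAt ℝ n (fun y => ι (f y)) x) : ContDiffAt ℝ n f x := by
  induction n generalizing V F f with
  | zero =>
    rw [Nat.cast_zero, contDiffAt_zero] at h ⊢
    obtain ⟨s, hs, h⟩ := h
    exact ⟨s, hs, ι.isometry.isEmbedding.continuousOn_iff.2 h⟩
  | succ n ih =>
    rw [Nat.cast_add, Nat.cast_one] at h ⊢
    rw [contDiffAt_succ_iff_hasFDerivAt] at h ⊢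
    obtain ⟨f', ⟨s, hs, hd⟩, hf'⟩ := h
    choose! g' hg' hfg using fun y hy => ι.hasFDerivAt_of_comp (hd y hy)
    refine ⟨g', ⟨s, hs, hfg⟩, ih (ι.postcompCLM E) (hf'.congr_of_eventuallyEq ?_)⟩
    filter_upwards [hs] with y hy using hg' y hy

theorem LinearIsometry.contMDiff_of_comp {E : Type u} {V F : Type (max u v)}
    [NormedAddCommGroup E] [NormedSpace ℝ E] [NormedAddCommGroup V] [NormedSpace ℝ V]
    [CompleteSpace V] [NormedAddCommGroup F] [NormedSpace ℝ F]
    {M : Type*} [TopologicalSpace M] [ChartedSpace E M] (ι : V →ₗᵢ[ℝ] F) {f : M → V}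
    (h : ContMDiff 𝓘(ℝ, E) 𝓘(ℝ, F) ∞ (fun y => ι (f y))) : ContMDiff 𝓘(ℝ, E) 𝓘(ℝ, V) ∞ f := by
  rw [contMDiff_infty] at h ⊢
  intro n x
  have hx := h n x
  rw [contMDiffAt_iff] at hx ⊢
  refine ⟨ι.isometry.isEmbedding.continuousAt_iff.2 hx.1, ?_⟩
  have h2 := hx.2
  simp only [mfld_simps, contDiffWithinAt_univ] at h2 ⊢
  exact ι.contDiffAt_of_comp h2

end CodRestrict

/-! ### A variational principle for closed sets -/

section Tangent

variable {E : Type*} [NormedAddCommGroup E] [NormedSpace ℝ E] [CompleteSpace E]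

/-- A closed subset of a Banach space to which, at each of its points near `c₀`, every direction is
tangent, is a neighbourhood of `c₀`. -/
theorem ball_subset_of_forall_tangent {C : Set E} {c₀ : E} {r : ℝ} (hC : IsClosed C)
    (h0 : c₀ ∈ C) (hT : ∀ c ∈ C, c ∈ Metric.ball c₀ r → ∀ e : E, ∀ ε > 0,
      ∃ t > (0 : ℝ), t ≤ 1 ∧ ∃ c' ∈ C, ‖c' - (c + t • e)‖ ≤ ε * t) :
    Metric.ball c₀ (r / 4) ⊆ C := by
  intro q hq
  let φ : E → ℝ := fun c => ‖c - q‖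
  have hφ : Continuous φ := by fun_prop
  have hφ0 : ∀ c, 0 ≤ φ c := fun c => norm_nonneg _
  -- Ekeland's order. With ε = φ c / 2, a tangent step of size t towards q moves by at most (3/2) t
  -- φ c and lowers φ by at least (1/2) t φ c; hence the factor 3.
  let R : E → E → Prop := fun c c' => c' ∈ C ∧ ‖c' - c‖ ≤ 3 * (φ c - φ c')
  have Rtrans : ∀ a b c, R a b → R b c → R a c := fun a b c h1 h2 => by
    refine ⟨h2.1, ?_⟩
    have : c - a = (c - b) + (b - a) := by abel
    rw [this]
    linarith [norm_add_le (c - b) (b - a), h1.2, h2.2]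
  -- Some successor has φ at most the mean of φ c and the infimum of φ over all successors;
  -- iterating, the limit minimises φ among its own successors.
  have hstep : ∀ c, c ∈ C → ∃ c', R c c' ∧ ∀ d, R c d → 2 * φ c' ≤ φ c + φ d := by
    intro c hc
    have hbdd : BddBelow (φ '' {d | R c d}) := ⟨0, by rintro _ ⟨d, -, rfl⟩; exact hφ0 d⟩
    have hcc : R c c := ⟨hc, by simp⟩
    set m := sInf (φ '' {d | R c d}) with hm
    have hle : ∀ d, R c d → m ≤ φ d := fun d hd => csInf_le hbdd ⟨d, hd, rfl⟩
    rcases (hle c hcc).eq_or_lt with h | h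
    · exact ⟨c, hcc, fun d hd => by linarith [hle d hd]⟩
    · obtain ⟨_, ⟨c', hc', rfl⟩, h'⟩ :=
        exists_lt_of_csInf_lt (⟨_, c, hcc, rfl⟩ : (φ '' {d | R c d}).Nonempty)
          (show m < (φ c + m) / 2 by linarith)
      exact ⟨c', hc', fun d hd => by linarith [hle d hd]⟩
  choose! next hnext hmin using hstep
  let s : ℕ → E := fun n => next^[n] c₀
  have hs : ∀ n, s (n + 1) = next (s n) := fun n => Function.iterate_succ_apply' _ _ _
  have hsC : ∀ n, s n ∈ C := by
    intro n
    induction n with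
    | zero => exact h0
    | succ n ih => rw [hs]; exact (hnext _ ih).1
  have hR1 : ∀ n, R (s n) (s (n + 1)) := fun n => by rw [hs]; exact hnext _ (hsC n)
  have hR : ∀ n k, R (s n) (s (n + k)) := by
    intro n k
    induction k with
    | zero => exact ⟨hsC n, by simp⟩
    | succ k ih => exact Rtrans _ _ _ ih (hR1 (n + k))
  have hanti : Antitone (fun n => φ (s n)) := antitone_nat_of_succ_le fun n => by
    linarith [(hR1 n).2, norm_nonneg (s (n + 1) - s n)]
  have hlim := tendsto_atTop_ciInf hanti ⟨0, by rintro _ ⟨n, rfl⟩; exact hφ0 _⟩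
  set l := ⨅ n, φ (s n)
  have hcau : CauchySeq s := by
    rw [Metric.cauchySeq_iff']
    intro ε hε
    obtain ⟨N, hN⟩ := ((hlim.eventually (gt_mem_nhds (show l < l + ε / 3 by linarith)))).exists
    refine ⟨N, fun n hn => ?_⟩
    obtain ⟨k, rfl⟩ := Nat.exists_eq_add_of_le hn
    have h1 : l ≤ φ (s (N + k)) := hanti.le_of_tendsto hlim _
    rw [dist_eq_norm]
    linarith [(hR N k).2]
  obtain ⟨c, hc⟩ := cauchySeq_tendsto_of_complete hcau
  have hcC : c ∈ C := hC.mem_of_tendsto hc (Eventually.of_forall hsC)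
  have hφc : φ c = l := tendsto_nhds_unique ((hφ.tendsto c).comp hc) hlim
  have hRc : ∀ n, R (s n) c := fun n => by
    refine ⟨hcC, ?_⟩
    have h1 : Tendsto (fun k => s (n + k)) atTop (𝓝 c) := by
      simpa [add_comm] using (tendsto_add_atTop_iff_nat n).2 hc
    refine le_of_tendsto_of_tendsto (h1.sub_const (s n)).norm
      ((tendsto_const_nhds (x := φ (s n))).sub ((hφ.tendsto c).comp h1) |>.const_mul 3)
      (Eventually.of_forall fun k => (hR n k).2)
  have hmin' : ∀ d, R c d → φ c ≤ φ d := fun d hd => by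
    have h1 : ∀ n, 2 * φ (s (n + 1)) ≤ φ (s n) + φ d := fun n => by
      rw [hs]; exact hmin _ (hsC n) d (Rtrans _ _ _ (hRc n) hd)
    have h2 := le_of_tendsto_of_tendsto' ((hlim.comp (tendsto_add_atTop_nat 1)).const_mul 2)
      (hlim.add_const (φ d)) h1
    linarith
  by_contra hqC
  have hpos : 0 < φ c := norm_pos_iff.2 fun h => hqC (by rw [← sub_eq_zero.1 h]; exact hcC)
  -- The total displacement is at most 3 φ c₀ < 3r/4; this is what the radius r / 4 is for.
  have hball : c ∈ Metric.ball c₀ r := by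
    have h1 := (hRc 0).2
    have h2 : φ c₀ < r / 4 := by
      have := Metric.mem_ball'.1 hq
      rwa [dist_eq_norm] at this
    rw [Metric.mem_ball, dist_eq_norm]
    change ‖c - c₀‖ ≤ 3 * (φ c₀ - φ c) at h1
    linarith [norm_nonneg (c - c₀)]
  obtain ⟨t, ht, ht1, c', hc', hle⟩ := hT c hcC hball (q - c) (φ c / 2) (by linarith)
  have hn : ‖q - c‖ = φ c := norm_sub_rev _ _
  have h1 : φ c' ≤ (1 - t / 2) * φ c := by
    have e1 : c' - q = (c' - (c + t • (q - c))) + (1 - t) • (c - q) := by module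
    have := norm_add_le (c' - (c + t • (q - c))) ((1 - t) • (c - q))
    rw [← e1, norm_smul, Real.norm_of_nonneg (by linarith)] at this
    change φ c' ≤ _ + (1 - t) * φ c at this
    linarith
  have h2 : ‖c' - c‖ ≤ 3 / 2 * t * φ c := by
    have e1 : c' - c = (c' - (c + t • (q - c))) + t • (q - c) := by module
    have := norm_add_le (c' - (c + t • (q - c))) (t • (q - c))
    rw [← e1, norm_smul, Real.norm_of_nonneg ht.le, hn] at this
    linarith
  have h3 := hmin' c' ⟨hc', by linarith⟩
  have : 0 < t * φ c := by positivity
  linarith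

end Tangent

/-! ### Closures of the operators of a pre-representation -/

theorem inner_deriv_eq_neg_of_isometry {H : Type*} [NormedAddCommGroup H]
    [InnerProductSpace ℂ H] (U : ℝ → H ≃ₗᵢ[ℂ] H) (h0 : U 0 = 1) {v y u z : H}
    (hv : HasDerivAt (fun t => U t v) y 0) (hu : HasDerivAt (fun t => U t u) z 0) :
    inner ℂ y u = -inner ℂ v z := by
  have h1 := hv.inner ℂ hu
  simp only [LinearIsometryEquiv.inner_map_map, h0, LinearIsometryEquiv.coe_one, id] at h1
  linear_combination h1.unique (hasDerivAt_const (0 : ℝ) (inner ℂ v u))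

section CoreOperators

variable {E : Type*} [NormedAddCommGroup E] [NormedSpace ℝ E] [CompleteSpace E]
  {G : Type*} [TopologicalSpace G] [ChartedSpace E G] [Group G] [LieGroup 𝓘(ℝ, E) ω G]
  {𝔤 : Type*} [NormedAddCommGroup 𝔤] [NormedSpace ℝ 𝔤]
  {H : Type*} [NormedAddCommGroup H] [InnerProductSpace ℂ H] [CompleteSpace H]
  {S : BanachLieSupergroup E G 𝔤} {Γ : HilbertGrading H}

namespace PreRepresentation

variable (P : PreRepresentation S Γ)

/-- The closure of the graph of `ρ(a)`. -/
def clGraph (a : 𝔤) : Submodule ℂ (H × H) := (P.op a).graph.topologicalClosure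

theorem rho_mem_graph (a : 𝔤) (u : P.B) : ((u : H), (P.rho a u : H)) ∈ (P.op a).graph :=
  (P.op a).mem_graph u

theorem rho_mem_clGraph (a : 𝔤) (u : P.B) : ((u : H), (P.rho a u : H)) ∈ P.clGraph a :=
  Submodule.le_topologicalClosure _ (P.rho_mem_graph a u)

theorem isClosed_clGraph (a : 𝔤) : IsClosed (P.clGraph a : Set (H × H)) :=
  Submodule.isClosed_topologicalClosure _

theorem clGraph_induction {a : 𝔤} {p : H × H → Prop} (hc : IsClosed {x | p x})
    (hp : ∀ u : P.B, p ((u : H), (P.rho a u : H))) {x : H × H} (hx : x ∈ P.clGraph a) : p x := by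
  refine closure_minimal (t := {x | p x}) (fun x hx => ?_) hc hx
  obtain ⟨u, h⟩ := (LinearPMap.mem_graph_iff' _).1 hx
  rw [← h]
  exact hp u

theorem eq_of_forall_inner_B {y y' : H} (h : ∀ u : P.B, inner ℂ y (u : H) = inner ℂ y' (u : H)) :
    y = y' :=
  P.dense_B.eq_of_inner_left ℂ fun u hu => h ⟨u, hu⟩

theorem inner_rho_odd {a : 𝔤} (ha : a ∈ S.alg.part 1) (v w : P.B) :
    inner ℂ (P.rho a v : H) (w : H) = -Complex.I * inner ℂ (v : H) (P.rho a w : H) := by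
  have h : inner ℂ (Complex.exp (-(Real.pi * Complex.I / 4)) • (P.rho a v : H)) (w : H)
      = inner ℂ (v : H) (Complex.exp (-(Real.pi * Complex.I / 4)) • (P.rho a w : H)) :=
    P.rho_odd a ha v w
  rw [inner_smul_left, inner_smul_right, ← Complex.exp_conj] at h
  have e1 : (starRingEnd ℂ) (-(Real.pi * Complex.I / 4)) = Real.pi * Complex.I / 4 := by
    have h4 : (starRingEnd ℂ) 4 = 4 := map_ofNat _ 4
    simp [Complex.conj_ofReal, neg_div, h4]
  have e2 : Complex.exp (-(Real.pi * Complex.I / 4)) * Complex.exp (-(Real.pi * Complex.I / 4))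
      = -Complex.I := by
    rw [← Complex.exp_add, ← Complex.exp_neg_pi_div_two_mul_I]
    congr 1
    ring
  have e3 : Complex.exp (-(Real.pi * Complex.I / 4)) * Complex.exp (Real.pi * Complex.I / 4) = 1 := by
    rw [← Complex.exp_add]
    simp
  rw [e1] at h
  rw [← e2, mul_assoc, ← h, ← mul_assoc, e3, one_mul]

/-- Since B is dense, this determines y from v. It yields closability, and lets closures for
different `a` be compared. -/
theorem inner_of_mem_clGraph_odd {a : 𝔤} (ha : a ∈ S.alg.part 1) {v y : H}
    (h : (v, y) ∈ P.clGraph a) (u : P.B) :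
    inner ℂ y (u : H) = -Complex.I * inner ℂ v (P.rho a u : H) :=
  P.clGraph_induction (p := fun x => inner ℂ x.2 (u : H) = -Complex.I * inner ℂ x.1 (P.rho a u : H))
    (isClosed_eq (by fun_prop) (by fun_prop)) (fun w => P.inner_rho_odd ha w u) h

theorem eq_of_mem_clGraph_odd {a : 𝔤} (ha : a ∈ S.alg.part 1) {v y y' : H}
    (h : (v, y) ∈ P.clGraph a) (h' : (v, y') ∈ P.clGraph a) : y = y' :=
  P.eq_of_forall_inner_B fun u => by
    rw [P.inner_of_mem_clGraph_odd ha h, P.inner_of_mem_clGraph_odd ha h']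

theorem isClosable_op_odd {a : 𝔤} (ha : a ∈ S.alg.part 1) : (P.op a).IsClosable := by
  refine ⟨(P.clGraph a).toLinearPMap, (Submodule.toLinearPMap_graph_eq _ ?_).symm⟩
  rintro ⟨v, y⟩ h rfl
  exact P.eq_of_mem_clGraph_odd ha h (Submodule.zero_mem _)

theorem isClosable_op_even {a : 𝔤} (ha : a ∈ S.alg.part 0) : (P.op a).IsClosable :=
  (P.rho_skew a ha).2.1

theorem mem_closure_domain_of_mem_clGraph {a : 𝔤} (ha : (P.op a).IsClosable) {v y : H}
    (h : (v, y) ∈ P.clGraph a) : v ∈ (P.op a).closure.domain := by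
  rw [clGraph, ha.graph_closure_eq_closure_graph] at h
  exact LinearPMap.mem_domain_of_mem_graph h

theorem mem_clGraph_closure {a : 𝔤} (ha : (P.op a).IsClosable) (v : (P.op a).closure.domain) :
    ((v : H), (P.op a).closure v) ∈ P.clGraph a := by
  rw [clGraph, ha.graph_closure_eq_closure_graph]
  exact LinearPMap.mem_graph _ v

theorem rho_sq {a : 𝔤} (ha : a ∈ S.alg.part 1) (v : P.B) :
    P.rho (S.alg.bracket a a) v = (2 : ℝ) • P.rho a (P.rho a v) := by
  rw [P.rho_bracket 1 1 a ha a ha]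
  have : superSign 1 1 = -1 := by simp [superSign, ZMod.val_one]
  rw [this]
  simp [two_smul]

/-- Up to a unimodular factor the left side is ⟨v, ρ(a)²v⟩, and ρ(a)² = ½ρ([a,a]). -/
theorem norm_rho_odd_sq_le {a : 𝔤} (ha : a ∈ S.alg.part 1) (v : P.B) :
    ‖(P.rho a v : H)‖ ^ 2 ≤ 1 / 2 * ‖(v : H)‖ * ‖(P.rho (S.alg.bracket a a) v : H)‖ := by
  have h : ‖inner ℂ (P.rho a v : H) (P.rho a v : H)‖ = ‖(P.rho a v : H)‖ ^ 2 := by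
    rw [inner_self_eq_norm_sq_to_K]
    simp
  rw [P.rho_sq ha, Submodule.coe_smul_of_tower, norm_smul, Real.norm_ofNat,
    ← h, P.inner_rho_odd ha v (P.rho a v), norm_mul, norm_neg, Complex.norm_I]
  linarith [norm_inner_le_norm (𝕜 := ℂ) (v : H) (P.rho a (P.rho a v) : H)]

theorem exists_mem_clGraph_odd {a : 𝔤} (ha : a ∈ S.alg.part 1) {v z : H}
    (h : (v, z) ∈ P.clGraph (S.alg.bracket a a)) :
    ∃ y, (v, y) ∈ P.clGraph a ∧ ‖y‖ ^ 2 ≤ 1 / 2 * ‖v‖ * ‖z‖ := by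
  obtain ⟨s, hs, hlim⟩ := mem_closure_iff_seq_limit.1 (show (v, z) ∈ closure _ from h)
  have hex : ∀ n, ∃ u : P.B, ((u : H), (P.rho (S.alg.bracket a a) u : H)) = s n :=
    fun n => (LinearPMap.mem_graph_iff' _).1 (hs n)
  choose u hu using hex
  obtain rfl : s = fun n => ((u n : H), (P.rho (S.alg.bracket a a) (u n) : H)) :=
    funext fun n => (hu n).symm
  have h1 : Tendsto (fun n => (u n : H)) atTop (𝓝 v) := (continuous_fst.tendsto _).comp hlim
  have h2 : Tendsto (fun n => (P.rho (S.alg.bracket a a) (u n) : H)) atTop (𝓝 z) :=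
    (continuous_snd.tendsto _).comp hlim
  -- The quadratic bound, applied to the differences of the approximating sequence.
  have hcau : CauchySeq fun n => (P.rho a (u n) : H) := by
    rw [Metric.cauchySeq_iff]
    intro ε hε
    obtain ⟨N1, hN1⟩ := Metric.cauchySeq_iff.1 h1.cauchySeq ε hε
    obtain ⟨N2, hN2⟩ := Metric.cauchySeq_iff.1 h2.cauchySeq ε hε
    refine ⟨max N1 N2, fun m hm n hn => ?_⟩
    have e1 := hN1 m (le_of_max_le_left hm) n (le_of_max_le_left hn)
    have e2 := hN2 m (le_of_max_le_right hm) n (le_of_max_le_right hn)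
    have e3 := P.norm_rho_odd_sq_le ha (u m - u n)
    rw [map_sub (P.rho a), map_sub (P.rho _), Submodule.coe_sub, Submodule.coe_sub,
      Submodule.coe_sub] at e3
    rw [dist_eq_norm] at e1 e2 ⊢
    refine lt_of_pow_lt_pow_left₀ 2 hε.le (e3.trans_lt ?_)
    nlinarith [mul_lt_mul'' e1 e2 (norm_nonneg _) (norm_nonneg _)]
  obtain ⟨y, hy⟩ := cauchySeq_tendsto_of_complete hcau
  refine ⟨y, (P.isClosed_clGraph a).mem_of_tendsto (h1.prodMk_nhds hy)
    (Eventually.of_forall fun n => P.rho_mem_clGraph a (u n)), ?_⟩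
  exact le_of_tendsto_of_tendsto' (hy.norm.pow 2) ((h1.norm.const_mul _).mul h2.norm)
    fun n => P.norm_rho_odd_sq_le ha (u n)

theorem expCurve_zero (X : GroupLieAlgebra 𝓘(ℝ, E) G) : expCurve X 0 = 1 :=
  (isExpCurve_expCurve X).1

theorem hasDerivAt_rho (X : GroupLieAlgebra 𝓘(ℝ, E) G) (u : P.B) :
    HasDerivAt (fun t => P.π.toHom (expCurve X t) (u : H)) (P.rho (S.lieEquiv X) u : H) 0 := by
  have h := P.rho_even X
  have hu : (u : H) ∈ (P.π.dpi X).domain := h.1 u.2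
  have h2 : (P.rho (S.lieEquiv X) u : H) = P.π.dpi X ⟨u, hu⟩ := h.2 rfl
  rw [h2]
  exact DifferentiableAt.hasDerivAt hu

theorem inner_rho_even (X : GroupLieAlgebra 𝓘(ℝ, E) G) {v y : H}
    (h : HasDerivAt (fun t => P.π.toHom (expCurve X t) v) y 0) (u : P.B) :
    inner ℂ y (u : H) = -inner ℂ v (P.rho (S.lieEquiv X) u : H) :=
  inner_deriv_eq_neg_of_isometry (fun t => P.π.toHom (expCurve X t))
    (by rw [expCurve_zero, map_one]) h (P.hasDerivAt_rho X u)

/-- Unitarity shows that the adjoint of the closure sends v to -y, and that adjoint is minus the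
closure. -/
theorem mem_clGraph_of_hasDerivAt (X : GroupLieAlgebra 𝓘(ℝ, E) G) {v y : H}
    (h : HasDerivAt (fun t => P.π.toHom (expCurve X t) v) y 0) :
    (v, y) ∈ P.clGraph (S.lieEquiv X) := by
  obtain ⟨hd, hc, hadj⟩ := P.rho_skew (S.lieEquiv X) (S.lieEquiv X).2
  change (P.op (S.lieEquiv X)).IsClosable at hc
  change (P.op (S.lieEquiv X)).closure.adjoint = -(P.op (S.lieEquiv X)).closure at hadj
  set A := (P.op (S.lieEquiv X)).closure with hA
  have hdA : Dense (A.domain : Set H) :=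
    Dense.mono (P.op (S.lieEquiv X)).le_closure.1 hd
  have key : ∀ x : A.domain, inner ℂ (-y) (x : H) = inner ℂ v (A x) := fun x => by
    refine P.clGraph_induction (p := fun x => inner ℂ (-y) x.1 = inner ℂ v x.2)
      (isClosed_eq (by fun_prop) (by fun_prop)) (fun w => ?_) (P.mem_clGraph_closure hc x)
    rw [inner_neg_left, P.inner_rho_even X h w, neg_neg]
  have hv : v ∈ A.adjoint.domain := LinearPMap.mem_adjoint_domain_of_exists v ⟨-y, key⟩
  have hval : A.adjoint ⟨v, hv⟩ = -y := LinearPMap.adjoint_apply_eq hdA _ key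
  have hg : (v, -y) ∈ A.adjoint.graph := hval ▸ LinearPMap.mem_graph _ (⟨v, hv⟩ : A.adjoint.domain)
  rw [hadj, LinearPMap.mem_graph_iff] at hg
  obtain ⟨w, hw1, hw2⟩ := hg
  have hw : A w = y := neg_injective hw2
  have := P.mem_clGraph_closure hc w
  rwa [show ((w : H)) = v from hw1, show (P.op (S.lieEquiv X)).closure w = y from hw] at this

end PreRepresentation

end CoreOperators

/-! ### The odd action as a bounded bilinear map -/

section OddAction

variable {E : Type*} [NormedAddCommGroup E] [NormedSpace ℝ E] [CompleteSpace E]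
  {G : Type*} [TopologicalSpace G] [ChartedSpace E G] [Group G] [LieGroup 𝓘(ℝ, E) ω G]
  {𝔤 : Type*} [NormedAddCommGroup 𝔤] [NormedSpace ℝ 𝔤]
  {H : Type*} [NormedAddCommGroup H] [InnerProductSpace ℂ H] [CompleteSpace H]
  {S : BanachLieSupergroup E G 𝔤} {Γ : HilbertGrading H}

theorem BanachLieSuperalgebra.bracket_odd_odd_mem (A : BanachLieSuperalgebra 𝔤) {a b : 𝔤}
    (ha : a ∈ A.part 1) (hb : b ∈ A.part 1) : A.bracket a b ∈ A.part 0 :=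
  A.bracket_mem 1 1 a ha b hb

theorem BanachLieSuperalgebra.bracket_even_odd_mem (A : BanachLieSuperalgebra 𝔤) {a b : 𝔤}
    (ha : a ∈ A.part 0) (hb : b ∈ A.part 1) : A.bracket a b ∈ A.part 1 :=
  A.bracket_mem 0 1 a ha b hb

namespace PreRepresentation

variable (P : PreRepresentation S Γ)

/-- The pairs `(v, T)` such that `v` lies in the domain of the closure of `ρ(X)` for all even `X`,
and `T` is the continuous linear map that sends `X` to the value of this closure at `v`. -/
def tangentPairSubmodule : Submodule ℝ (H × (E →L[ℝ] H)) where
  carrier := {p | ∀ X : GroupLieAlgebra 𝓘(ℝ, E) G, (p.1, p.2 X) ∈ P.clGraph (S.lieEquiv X)}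
  add_mem' := fun hp hq X => Submodule.add_mem _ (hp X) (hq X)
  zero_mem' := fun _ => Submodule.zero_mem _
  smul_mem' := fun c _ hp X => ((P.clGraph (S.lieEquiv X)).restrictScalars ℝ).smul_mem c (hp X)

/-- This makes `TangentPairs` complete, as `LinearIsometry.contMDiff_of_comp` requires. -/
theorem isClosed_tangentPairSubmodule : IsClosed (P.tangentPairSubmodule : Set (H × (E →L[ℝ] H))) := by
  change IsClosed {p : H × (E →L[ℝ] H) |
    ∀ X : GroupLieAlgebra 𝓘(ℝ, E) G, (p.1, p.2 X) ∈ P.clGraph (S.lieEquiv X)}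
  rw [Set.ofPred_forall]
  have hcont : ∀ X : E, Continuous fun p : H × (E →L[ℝ] H) => (p.1, p.2 X) := fun X => by fun_prop
  exact isClosed_iInter fun X => (P.isClosed_clGraph (S.lieEquiv X)).preimage (hcont X)

/-- The type of elements of `tangentPairSubmodule`, as a Banach space. -/
def TangentPairs : Type _ := P.tangentPairSubmodule

instance : NormedAddCommGroup P.TangentPairs :=
  inferInstanceAs (NormedAddCommGroup P.tangentPairSubmodule)

instance : NormedSpace ℝ P.TangentPairs := inferInstanceAs (NormedSpace ℝ P.tangentPairSubmodule)

instance : CompleteSpace P.TangentPairs := P.isClosed_tangentPairSubmodule.completeSpace_coe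

/-- The inclusion of `TangentPairs`. -/
def toProd : P.TangentPairs →ₗᵢ[ℝ] H × (E →L[ℝ] H) := P.tangentPairSubmodule.subtypeₗᵢ

theorem exists_bound_oddAction : ∃ K : ℝ, ∀ (a : S.alg.part 1) (p : P.TangentPairs),
    ∃ y, ((P.toProd p).1, y) ∈ P.clGraph a ∧ ‖y‖ ≤ K * ‖a‖ * ‖p‖ := by
  let L : S.alg.part 0 →L[ℝ] E :=
    (S.lieEquiv.symm : S.alg.part 0 →L[ℝ] GroupLieAlgebra 𝓘(ℝ, E) G)
  -- Any K ≥ 0 with K² ≥ ‖L‖ / 2 would do; this choice avoids a square root.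
  refine ⟨1 + ‖L‖, fun a p => ?_⟩
  let b : S.alg.part 0 := ⟨S.alg.bracket a a, S.alg.bracket_odd_odd_mem a.2 a.2⟩
  have hp : ((P.toProd p).1, (P.toProd p).2 (L b)) ∈ P.clGraph (S.lieEquiv (L b)) := p.2 (L b)
  rw [show S.lieEquiv (L b) = b from S.lieEquiv.apply_symm_apply b] at hp
  obtain ⟨y, hy, hle⟩ := P.exists_mem_clGraph_odd a.2 hp
  refine ⟨y, hy, ?_⟩
  have hb : ‖b‖ ≤ ‖a‖ * ‖a‖ := S.alg.norm_bracket_le a a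
  have h1 : ‖(P.toProd p).1‖ ≤ ‖p‖ := (norm_fst_le _).trans_eq (P.toProd.norm_map p)
  have h2 : ‖(P.toProd p).2‖ ≤ ‖p‖ := (norm_snd_le _).trans_eq (P.toProd.norm_map p)
  have h3 : ‖(P.toProd p).2 (L b)‖ ≤ ‖p‖ * (‖L‖ * (‖a‖ * ‖a‖)) :=
    (ContinuousLinearMap.le_opNorm _ _).trans (mul_le_mul h2
      ((L.le_opNorm b).trans (mul_le_mul_of_nonneg_left hb (norm_nonneg _)))
      (norm_nonneg _) (norm_nonneg _))
  refine le_of_sq_le_sq (hle.trans ?_) (by positivity)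
  calc 1 / 2 * ‖(P.toProd p).1‖ * ‖(P.toProd p).2 (L b)‖
      ≤ 1 / 2 * ‖p‖ * (‖p‖ * (‖L‖ * (‖a‖ * ‖a‖))) := by gcongr
    _ = (1 / 2 * ‖L‖) * (‖a‖ * ‖p‖) ^ 2 := by ring
    _ ≤ (1 + ‖L‖) ^ 2 * (‖a‖ * ‖p‖) ^ 2 := by
        gcongr
        nlinarith [norm_nonneg L]
    _ = _ := by ring

/-- The function underlying `oddAction`. -/
def oddActionFun (a : S.alg.part 1) (p : P.TangentPairs) : H :=
  (P.exists_bound_oddAction.choose_spec a p).choose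

theorem oddActionFun_mem_clGraph (a : S.alg.part 1) (p : P.TangentPairs) :
    ((P.toProd p).1, P.oddActionFun a p) ∈ P.clGraph a :=
  (P.exists_bound_oddAction.choose_spec a p).choose_spec.1

theorem inner_oddActionFun (a : S.alg.part 1) (p : P.TangentPairs) (u : P.B) :
    inner ℂ (P.oddActionFun a p) (u : H)
      = -Complex.I * inner ℂ (P.toProd p).1 (P.rho a u : H) :=
  P.inner_of_mem_clGraph_odd a.2 (P.oddActionFun_mem_clGraph a p) u

theorem oddActionFun_smul_right (r : ℝ) (a : S.alg.part 1) (p : P.TangentPairs) :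
    P.oddActionFun a (r • p) = r • P.oddActionFun a p := by
  refine P.eq_of_forall_inner_B fun u => ?_
  have h1 : (P.toProd (r • p)).1
    = (r : ℂ) • (P.toProd p).1 := (Complex.coe_smul r _).symm
  rw [← Complex.coe_smul, inner_smul_left, inner_oddActionFun, inner_oddActionFun, h1,
    inner_smul_left]
  ring

/-- The continuous bilinear map `(a, (v, T)) ↦ ρ(a) v`, with `ρ(a)` replaced by its closure. -/
def oddAction : S.alg.part 1 →L[ℝ] P.TangentPairs →L[ℝ] H :=
  LinearMap.mkContinuous₂
    (LinearMap.mk₂ ℝ P.oddActionFun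
      -- Closures need not add up as operators; linearity in `a` is read off from pairings with B,
      -- where ρ is linear.
      (fun a b p => P.eq_of_forall_inner_B fun u => by
        simp [inner_oddActionFun, mul_add])
      (fun r a p => P.eq_of_forall_inner_B fun u => by
        rw [← Complex.coe_smul, inner_smul_left, inner_oddActionFun, inner_oddActionFun,
          Submodule.coe_smul, map_smul, LinearMap.smul_apply, Submodule.coe_smul_of_tower,
          ← Complex.coe_smul, inner_smul_right, Complex.conj_ofReal]
        ring)
      (fun a p q => P.eq_of_mem_clGraph_odd a.2 (P.oddActionFun_mem_clGraph a (p + q))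
        (Submodule.add_mem _ (P.oddActionFun_mem_clGraph a p) (P.oddActionFun_mem_clGraph a q)))
      P.oddActionFun_smul_right)
    P.exists_bound_oddAction.choose
    fun a p => (P.exists_bound_oddAction.choose_spec a p).choose_spec.2

theorem oddAction_mem_clGraph (a : S.alg.part 1) (p : P.TangentPairs) :
    ((P.toProd p).1, P.oddAction a p) ∈ P.clGraph a :=
  P.oddActionFun_mem_clGraph a p

theorem inner_oddAction (a : S.alg.part 1) (p : P.TangentPairs) (u : P.B) :
    inner ℂ (P.oddAction a p) (u : H)
      = -Complex.I * inner ℂ (P.toProd p).1 (P.rho a u : H) :=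
  P.inner_of_mem_clGraph_odd a.2 (P.oddAction_mem_clGraph a p) u

end PreRepresentation

end OddAction

/-! ### Banach–Lie groups: derivatives at 1, exponentials, closed subsets -/

section LieGroup

variable {E : Type*} [NormedAddCommGroup E] [NormedSpace ℝ E]
  {G : Type*} [TopologicalSpace G] [ChartedSpace E G] [Group G]
  {V : Type*} [NormedAddCommGroup V] [NormedSpace ℝ V]

/-- `differentialAtOne` as a continuous linear map on the model space. -/
def fderivAtOne (f : G → V) : E →L[ℝ] V := mfderiv 𝓘(ℝ, E) 𝓘(ℝ, V) f 1

theorem mulInvariantVectorField_one (X : GroupLieAlgebra 𝓘(ℝ, E) G) :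
    mulInvariantVectorField X (1 : G) = X := by
  have h : (fun x : G => 1 * x) = id := by ext; simp
  unfold mulInvariantVectorField
  rw [h, mfderiv_id]
  rfl

variable [LieGroup 𝓘(ℝ, E) ω G]

theorem contMDiff_mul_left_infty (g : G) : ContMDiff 𝓘(ℝ, E) 𝓘(ℝ, E) ∞ (g * ·) :=
  (contMDiff_mul_left (I := 𝓘(ℝ, E)) (n := ω) (a := g)).of_le le_top

theorem contMDiff_infty_mfderiv_one {f : G → G → V}
    (hf : ContMDiff (𝓘(ℝ, E).prod 𝓘(ℝ, E)) 𝓘(ℝ, V) ∞ (Function.uncurry f)) :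
    ContMDiff 𝓘(ℝ, E) 𝓘(ℝ, E →L[ℝ] V) ∞
      (fun g => fderivAtOne (E := E) (f g)) := by
  have : IsManifold 𝓘(ℝ, E) ∞ G := IsManifold.of_le (n := ω) le_top
  have : IsManifold 𝓘(ℝ, E) 1 G := IsManifold.of_le (n := ω) le_top
  intro g
  have h := ContMDiffAt.mfderiv (m := ∞) f (fun _ => (1 : G)) (hf (g, 1)) contMDiffAt_const le_rfl
  -- The base point is constantly 1, so the coordinate changes are trivial.
  have key : ∀ (ϕ : G → E →L[ℝ] V) (g' : G), inTangentCoordinates 𝓘(ℝ, E) 𝓘(ℝ, V)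
      (fun _ : G => (1 : G)) (fun x => f x 1) ϕ g g' = ϕ g' := fun ϕ g' => by
    rw [inTangentCoordinates_eq (fun _ : G => (1 : G)) (fun x => f x 1) ϕ (x₀ := g) (x := g')
      (mem_chart_source E (1 : G)) (mem_univ _)]
    ext e
    rw [ContinuousLinearMap.comp_apply, ContinuousLinearMap.comp_apply,
      tangentBundleCore_coordChange_model_space, ContinuousLinearMap.id_apply]
    exact congrArg (ϕ g') ((tangentBundleCore 𝓘(ℝ, E) G).coordChange_self _ _
      (mem_chart_source _ _) e)
  exact h.congr_of_eventuallyEq (Eventually.of_forall fun g' => (key (fun x => fderivAtOne (f x)) g').symm)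

variable [CompleteSpace E]

theorem hasDerivAt_comp_expCurve {f : G → V} (hf : MDifferentiableAt 𝓘(ℝ, E) 𝓘(ℝ, V) f 1)
    (X : GroupLieAlgebra 𝓘(ℝ, E) G) :
    HasDerivAt (fun t => f (expCurve X t)) (differentialAtOne f X) 0 := by
  -- `expCurve X 0 = 1` is not definitional, so facts at 1 are transported along an equation.
  have h2 : ∀ g : G, g = 1 → HasMFDerivAt 𝓘(ℝ, E) 𝓘(ℝ, V) f g
      (fderivAtOne f : E →L[ℝ] V) ∧ (mulInvariantVectorField X g : E) = X := by
    rintro _ rfl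
    exact ⟨hf.hasMFDerivAt, mulInvariantVectorField_one X⟩
  obtain ⟨h3, h4⟩ := h2 _ (isExpCurve_expCurve X).1
  let w : E := X
  have h1 : HasMFDerivAt 𝓘(ℝ, ℝ) 𝓘(ℝ, E) (expCurve X) 0
      ((1 : ℝ →L[ℝ] ℝ).smulRight w : ℝ →L[ℝ] E) :=
    ((isExpCurve_expCurve X).2 0).congr_mfderiv
      (congrArg (fun v : E => (1 : ℝ →L[ℝ] ℝ).smulRight v) h4)
  have h5 : HasFDerivAt (f ∘ expCurve X) ((fderivAtOne f : E →L[ℝ] V).comp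
      ((1 : ℝ →L[ℝ] ℝ).smulRight w)) 0 := (h3.comp (0 : ℝ) h1).hasFDerivAt
  have h6 := h5.hasDerivAt
  rw [ContinuousLinearMap.comp_apply, ContinuousLinearMap.smulRight_apply,
    one_apply_eq_self, one_smul] at h6
  exact h6

theorem isExpCurve_left_translate (X : GroupLieAlgebra 𝓘(ℝ, E) G) (s : ℝ) :
    IsExpCurve X (fun t => (expCurve X s)⁻¹ * expCurve X (t + s)) := by
  refine ⟨by simp, fun t => ?_⟩
  have h1 := (isExpCurve_expCurve X).2.comp_add s t
  have h2 : HasMFDerivAt 𝓘(ℝ, E) 𝓘(ℝ, E) ((expCurve X s)⁻¹ * ·) (expCurve X (t + s))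
      (mfderiv 𝓘(ℝ, E) 𝓘(ℝ, E) ((expCurve X s)⁻¹ * ·) (expCurve X (t + s))) :=
    ((contMDiff_mul_left_infty _).contMDiffAt.mdifferentiableAt (by simp)).hasMFDerivAt
  have h3 := h2.comp t h1
  have h4 : ∀ (D : E →L[ℝ] E) (v : E), D.comp ((1 : ℝ →L[ℝ] ℝ).smulRight v)
      = (1 : ℝ →L[ℝ] ℝ).smulRight (D v) := fun D v => by ext; simp
  rw [← mfderiv_mul_left_mulInvariantVectorField X]
  exact h3.congr_mfderiv (h4 _ _)

theorem expCurve_add (X : GroupLieAlgebra 𝓘(ℝ, E) G) (s t : ℝ) :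
    expCurve X (t + s) = expCurve X s * expCurve X t := by
  have h := congrFun ((isExpCurve_left_translate X s).unique (isExpCurve_expCurve X)) t
  rw [← h]
  simp

/-- A closed subset of a Banach--Lie group that is stable under right multiplication by exponentials
is a neighbourhood of the identity, if it contains it. -/
theorem mem_nhds_one_of_mul_expCurve_mem {N : Set G} (hN : IsClosed N) (h1 : (1 : G) ∈ N)
    (hmul : ∀ g ∈ N, ∀ (X : GroupLieAlgebra 𝓘(ℝ, E) G) (t : ℝ), g * expCurve X t ∈ N) :
    N ∈ 𝓝 (1 : G) := by
  have : IsManifold 𝓘(ℝ, E) ∞ G := IsManifold.of_le (n := ω) le_top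
  have : IsManifold 𝓘(ℝ, E) 1 G := IsManifold.of_le (n := ω) le_top
  set φ := extChartAt 𝓘(ℝ, E) (1 : G) with hφ
  have htarget : φ.target ∈ 𝓝 (φ 1) := extChartAt_target_mem_nhds 1
  obtain ⟨r, hr, hball⟩ := Metric.nhds_basis_closedBall.mem_iff.1 htarget
  -- Cutting down to a closed ball inside the chart target makes the image of N closed in E.
  let C : Set E := Metric.closedBall (φ 1) r ∩ φ.symm ⁻¹' N
  have hC : IsClosed C :=
    ((continuousOn_extChartAt_symm 1).mono hball).preimage_isClosed_of_isClosed
      Metric.isClosed_closedBall hN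
  have h0 : φ 1 ∈ C := ⟨Metric.mem_closedBall_self hr.le, by
    rw [mem_preimage, extChartAt_to_inv]; exact h1⟩
  have hsub := ball_subset_of_forall_tangent (r := r) hC h0 ?_
  · have hnh : φ ⁻¹' Metric.ball (φ 1) (r / 4) ∈ 𝓝 (1 : G) :=
      (continuousAt_extChartAt 1).preimage_mem_nhds (Metric.ball_mem_nhds _ (by linarith))
    filter_upwards [hnh, extChartAt_source_mem_nhds (I := 𝓘(ℝ, E)) (1 : G)] with g hg hgs
    have := (hsub hg).2
    rwa [mem_preimage, φ.left_inv hgs] at this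
  intro c hc hcr e ε hε
  have hct : c ∈ φ.target := hball hc.1
  set g := φ.symm c with hg
  have hgs : g ∈ φ.source := φ.map_target hct
  -- Since f ∘ k is the identity near c, the choice X = k' e makes t ↦ φ (g exp(tX)) leave c with
  -- velocity e.
  let k : E → G := fun y => g⁻¹ * φ.symm y
  let f : G → E := fun h => φ (g * h)
  have hk1 : k c = 1 := inv_mul_cancel g
  have hk : MDifferentiableAt 𝓘(ℝ, E) 𝓘(ℝ, E) k c := by
    have hs : ContMDiffAt 𝓘(ℝ, E) 𝓘(ℝ, E) ∞ φ.symm c :=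
      (contMDiffOn_extChartAt_symm 1).contMDiffAt (extChartAt_target_mem_nhds' hct)
    exact ((contMDiff_mul_left_infty g⁻¹).contMDiffAt.comp c hs).mdifferentiableAt (by simp)
  have hf : MDifferentiableAt 𝓘(ℝ, E) 𝓘(ℝ, E) f 1 := by
    have hs : ContMDiffAt 𝓘(ℝ, E) 𝓘(ℝ, E) ∞ φ (g * 1) := by
      rw [mul_one]
      exact contMDiffAt_extChartAt' (by rwa [extChartAt_source] at hgs)
    exact (hs.comp (1 : G) (contMDiff_mul_left_infty g).contMDiffAt).mdifferentiableAt (by simp)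
  let k' : E →L[ℝ] E := mfderiv 𝓘(ℝ, E) 𝓘(ℝ, E) k c
  let X : GroupLieAlgebra 𝓘(ℝ, E) G := k' e
  have hX : differentialAtOne f X = e := by
    have h2 : ∀ h : G, h = 1 → HasMFDerivAt 𝓘(ℝ, E) 𝓘(ℝ, E) f h
        (fderivAtOne f : E →L[ℝ] E) := by
      rintro _ rfl
      exact hf.hasMFDerivAt
    have h3 : HasFDerivAt (f ∘ k) ((fderivAtOne f : E →L[ℝ] E).comp k') c :=
      ((h2 _ hk1).comp c hk.hasMFDerivAt).hasFDerivAt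
    have h4 : HasFDerivAt (f ∘ k) (ContinuousLinearMap.id ℝ E) c := by
      refine (hasFDerivAt_id c).congr_of_eventuallyEq ?_
      filter_upwards [extChartAt_target_mem_nhds' hct] with y hy
      simp only [Function.comp_apply, f, k, mul_inv_cancel_left, id]
      exact φ.right_inv hy
    exact congrArg (fun L : E →L[ℝ] E => L e) (h3.unique h4)
  have hσ := hasDerivAt_comp_expCurve hf X
  rw [hX] at hσ
  have hσ0 : f (expCurve X 0) = c := by
    simp only [f, (isExpCurve_expCurve X).1, mul_one]
    exact φ.right_inv hct
  have hcont : ContinuousAt (expCurve X) 0 := ((isExpCurve_expCurve X).2 0).continuousAt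
  have : IsTopologicalGroup G := topologicalGroup_of_lieGroup 𝓘(ℝ, E) ω
  have ev1 : ∀ᶠ t in 𝓝 (0 : ℝ), f (expCurve X t) ∈ Metric.ball (φ 1) r :=
    hσ.continuousAt.eventually_mem (Metric.isOpen_ball.mem_nhds (by rwa [hσ0]))
  have ev2 : ∀ᶠ t in 𝓝 (0 : ℝ), g * expCurve X t ∈ φ.source := by
    have hc2 : ContinuousAt (fun t => g * expCurve X t) 0 := continuousAt_const.mul hcont
    refine hc2.eventually_mem ?_
    rw [(isExpCurve_expCurve X).1, mul_one]
    exact extChartAt_source_mem_nhds' hgs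
  have ev3 := (hasDerivAt_iff_isLittleO.1 hσ).def hε
  have ev4 : ∀ᶠ t in 𝓝[>] (0 : ℝ), t ∈ Ioc (0 : ℝ) 1 := Ioc_mem_nhdsGT one_pos
  obtain ⟨t, ⟨ht0, ht1⟩, h2, h3, h4⟩ :=
    (ev4.and ((ev1.and (ev2.and ev3)).filter_mono nhdsWithin_le_nhds)).exists
  refine ⟨t, ht0, ht1, f (expCurve X t), ⟨Metric.ball_subset_closedBall h2, ?_⟩, ?_⟩
  · rw [mem_preimage, φ.left_inv h3]
    exact hmul g hc.2 X t
  · rw [hσ0, sub_zero, Real.norm_of_nonneg ht0.le] at h4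
    rwa [← sub_sub]

end LieGroup

/-! ### Smooth vectors and equivariance of the odd action -/

section SmoothVectors

universe uE uH

variable {E : Type uE} [NormedAddCommGroup E] [NormedSpace ℝ E] [CompleteSpace E]
  {G : Type*} [TopologicalSpace G] [ChartedSpace E G] [Group G] [LieGroup 𝓘(ℝ, E) ω G]
  {𝔤 : Type*} [NormedAddCommGroup 𝔤] [NormedSpace ℝ 𝔤]
  {H : Type uH} [NormedAddCommGroup H] [InnerProductSpace ℂ H] [CompleteSpace H]
  {S : BanachLieSupergroup E G 𝔤} {Γ : HilbertGrading H}

namespace PreRepresentation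

variable (P : PreRepresentation S Γ)

theorem toHom_mul_apply (g h : G) (v : H) : P.π.toHom (g * h) v = P.π.toHom g (P.π.toHom h v) := by
  rw [map_mul]
  rfl

theorem contMDiff_orbit (v : P.smooth) :
    ContMDiff 𝓘(ℝ, E) 𝓘(ℝ, H) ∞ (fun g => P.π.toHom g (v : H)) := v.2

theorem contMDiff_orbit_mul (v : P.smooth) :
    ContMDiff (𝓘(ℝ, E).prod 𝓘(ℝ, E)) 𝓘(ℝ, H) ∞
      (fun p : G × G => P.π.toHom (p.1 * p.2) (v : H)) := by
  have : LieGroup 𝓘(ℝ, E) ∞ G := LieGroup.of_le (n := ω) le_top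
  exact (P.contMDiff_orbit v).comp (contMDiff_mul 𝓘(ℝ, E) ∞)

/-- The action of the group on the space of smooth vectors. -/
def translate (g : G) (v : P.smooth) : P.smooth :=
  ⟨P.π.toHom g v, by
    have h : ContMDiff 𝓘(ℝ, E) 𝓘(ℝ, H) ∞ (fun h : G => P.π.toHom (h * g) (v : H)) :=
      (P.contMDiff_orbit_mul v).comp (contMDiff_id.prodMk contMDiff_const)
    simp only [toHom_mul_apply] at h
    exact h⟩

/-- The derived action `X ↦ dπ(X) v` on a smooth vector `v`. -/
def derivedAction (v : P.smooth) : E →L[ℝ] H := fderivAtOne (fun g : G => P.π.toHom g (v : H))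

theorem hasDerivAt_derivedAction (v : P.smooth) (X : GroupLieAlgebra 𝓘(ℝ, E) G) :
    HasDerivAt (fun t => P.π.toHom (expCurve X t) (v : H)) (P.derivedAction v X) 0 :=
  hasDerivAt_comp_expCurve (((P.contMDiff_orbit v) 1).mdifferentiableAt (by simp)) X

theorem derivedAction_mem_clGraph (v : P.smooth) (X : GroupLieAlgebra 𝓘(ℝ, E) G) :
    ((v : H), P.derivedAction v X) ∈ P.clGraph (S.lieEquiv X) :=
  P.mem_clGraph_of_hasDerivAt X (P.hasDerivAt_derivedAction v X)

theorem derivedAction_mem_smooth (v : P.smooth) (X : GroupLieAlgebra 𝓘(ℝ, E) G) :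
    P.derivedAction v X ∈ P.smooth := by
  let f : G → G → H := fun g h => P.π.toHom (g * h) (v : H)
  have h1 : ContMDiff 𝓘(ℝ, E) 𝓘(ℝ, E →L[ℝ] H) ∞ (fun g => fderivAtOne (E := E) (f g)) :=
    contMDiff_infty_mfderiv_one (P.contMDiff_orbit_mul v)
  let w : E := X
  have h2 : ContMDiff 𝓘(ℝ, E) 𝓘(ℝ, H) ∞ (fun g => fderivAtOne (E := E) (f g) w) :=
    h1.clm_apply contMDiff_const
  refine h2.congr fun g => ?_
  have hf : MDifferentiableAt 𝓘(ℝ, E) 𝓘(ℝ, H) (f g) 1 :=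
    ((P.contMDiff_orbit_mul v).comp
      (contMDiff_const.prodMk contMDiff_id) 1).mdifferentiableAt (by simp)
  refine HasDerivAt.unique ?_ (hasDerivAt_comp_expCurve hf X)
  simp only [f, toHom_mul_apply]
  exact ((P.π.toHom g).toContinuousLinearEquiv.toContinuousLinearMap.restrictScalars
    ℝ).hasFDerivAt.comp_hasDerivAt (0 : ℝ) (P.hasDerivAt_derivedAction v X)

/-- The pair `(v, X ↦ dπ(X) v)` attached to a smooth vector `v`. -/
def tangentPair (v : P.smooth) : P.TangentPairs :=
  ⟨((v : H), P.derivedAction v), fun X => P.derivedAction_mem_clGraph v X⟩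

/-- The second component is the derivative at h = 1 of h ↦ π(hg)v, which is smooth in g for the
operator norm. -/
theorem contMDiff_tangentPair_translate (v : P.smooth) :
    ContMDiff 𝓘(ℝ, E) 𝓘(ℝ, P.TangentPairs) ∞ (fun g : G => P.tangentPair (P.translate g v)) := by
  refine LinearIsometry.contMDiff_of_comp.{uE, uH} P.toProd ?_
  refine (P.contMDiff_orbit v).prodMk_space ?_
  have h1 : ContMDiff (𝓘(ℝ, E).prod 𝓘(ℝ, E)) 𝓘(ℝ, H) ∞
      (Function.uncurry fun g h : G => P.π.toHom (h * g) (v : H)) :=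
    (P.contMDiff_orbit_mul v).comp (contMDiff_snd.prodMk contMDiff_fst)
  have h2 := contMDiff_infty_mfderiv_one h1
  simp only [toHom_mul_apply] at h2
  exact h2

/-- The adjoint action on the odd part. -/
def adOdd (g : G) (a : S.alg.part 1) : S.alg.part 1 := ⟨S.Ad g a, S.Ad_mem g 1 a a.2⟩

/-- The map `g ↦ ρ(Ad(g) a) π(g) v`, with `ρ(Ad(g) a)` replaced by its closure. -/
def oddOrbit (a : S.alg.part 1) (v : P.smooth) (g : G) : H :=
  P.oddAction (adOdd g a) (P.tangentPair (P.translate g v))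

theorem oddOrbit_mul (a : S.alg.part 1) (v : P.smooth) (g h : G) :
    P.oddOrbit a v (g * h) = P.oddOrbit (adOdd h a) (P.translate h v) g := by
  have h1 : adOdd (g * h) a = adOdd g (adOdd h a) := Subtype.ext (by
    simp only [adOdd, map_mul]
    rfl)
  have h2 : P.translate (g * h) v = P.translate g (P.translate h v) :=
    Subtype.ext (P.toHom_mul_apply g h v)
  rw [oddOrbit, h1, h2]
  rfl

theorem adOdd_one (a : S.alg.part 1) : adOdd (1 : G) a = a := Subtype.ext (by
  simp only [adOdd, map_one]
  rfl)

theorem translate_one (v : P.smooth) : P.translate 1 v = v := Subtype.ext (by simp [translate])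

theorem oddOrbit_one (a : S.alg.part 1) (v : P.smooth) :
    P.oddOrbit a v 1 = P.oddAction a (P.tangentPair v) := by
  rw [oddOrbit, adOdd_one, translate_one]

theorem isClosable_op {i : ZMod 2} {a : 𝔤} (ha : a ∈ S.alg.part i) : (P.op a).IsClosable := by
  fin_cases i
  · exact P.isClosable_op_even ha
  · exact P.isClosable_op_odd ha

variable [CompleteSpace 𝔤]

omit [CompleteSpace H] in
theorem contMDiff_adOdd (a : S.alg.part 1) :
    ContMDiff 𝓘(ℝ, E) 𝓘(ℝ, S.alg.part 1) ∞ (fun g : G => adOdd g a) := by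
  -- The even and odd parts are closed complements in a Banach space, so the projection onto the odd
  -- part is continuous.
  obtain ⟨p, hp⟩ := Submodule.ClosedComplemented.of_isCompl_isClosed S.alg.isCompl.symm
    (S.alg.isClosed_part 1) (S.alg.isClosed_part 0)
  have h : ContMDiff 𝓘(ℝ, E) 𝓘(ℝ, S.alg.part 1) ∞
      (fun g : G => p ((S.Ad g : 𝔤 →L[ℝ] 𝔤) (a : 𝔤))) :=
    p.contMDiff.comp ((S.Ad_analytic.of_le le_top).clm_apply contMDiff_const)
  exact h.congr fun g => (hp (adOdd g a)).symm

theorem contMDiff_oddOrbit (a : S.alg.part 1) (v : P.smooth) :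
    ContMDiff 𝓘(ℝ, E) 𝓘(ℝ, H) ∞ (P.oddOrbit a v) :=
  (P.oddAction.contMDiff.comp (contMDiff_adOdd a)).clm_apply (P.contMDiff_tangentPair_translate v)

theorem hasDerivAt_adOdd (a : S.alg.part 1) (X : GroupLieAlgebra 𝓘(ℝ, E) G) :
    HasDerivAt (fun t => adOdd (expCurve X t) a)
      (⟨S.alg.bracket (S.lieEquiv X) a,
        S.alg.bracket_even_odd_mem (S.lieEquiv X).2 a.2⟩ : S.alg.part 1) 0 := by
  obtain ⟨p, hp⟩ := Submodule.ClosedComplemented.of_isCompl_isClosed S.alg.isCompl.symm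
    (S.alg.isClosed_part 1) (S.alg.isClosed_part 0)
  have h1 := hasDerivAt_comp_expCurve ((S.Ad_analytic 1).mdifferentiableAt (by simp)) X
  have h2 := p.hasFDerivAt.comp_hasDerivAt (0 : ℝ) (h1.clm_apply (hasDerivAt_const (0 : ℝ) (a : 𝔤)))
  rw [S.Ad_deriv, map_zero, add_zero] at h2
  rw [hp ⟨_, S.alg.bracket_even_odd_mem (S.lieEquiv X).2 a.2⟩] at h2
  exact h2.congr_of_eventuallyEq
    (Eventually.of_forall fun t => (hp (adOdd (expCurve X t) a)).symm)

/-- The product rule gives ⟨ρ(a)v, z⟩ + ⟨ρ([X,a])v + ρ(a)dπ(X)v, u⟩. For u in B, moving all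
operators to the right makes this cancel by the bracket relation. More general u are needed because
π(exp(tX)) may carry u out of B. -/
theorem hasDerivAt_inner_oddOrbit_zero (a : S.alg.part 1) (v : P.smooth)
    (X : GroupLieAlgebra 𝓘(ℝ, E) G) {u z : H}
    (hu : HasDerivAt (fun t => P.π.toHom (expCurve X t) u) z 0) :
    HasDerivAt (fun t => inner ℂ (P.oddOrbit a v (expCurve X t)) (P.π.toHom (expCurve X t) u))
      0 0 := by
  let b : S.alg.part 1 := ⟨S.alg.bracket (S.lieEquiv X) a,
    S.alg.bracket_even_odd_mem (S.lieEquiv X).2 a.2⟩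
  have h1 : HasDerivAt (fun t => P.oddAction (adOdd (expCurve X t) a)) (P.oddAction b) 0 :=
    P.oddAction.hasFDerivAt.comp_hasDerivAt (0 : ℝ) (hasDerivAt_adOdd a X)
  have h2 := hasDerivAt_comp_expCurve
    ((P.contMDiff_tangentPair_translate v 1).mdifferentiableAt (by simp)) X
  set q : P.TangentPairs := differentialAtOne (fun g : G => P.tangentPair (P.translate g v)) X
  have hq : HasDerivAt (fun t => P.π.toHom (expCurve X t) (v : H)) (P.toProd q).1 0 :=
    ((ContinuousLinearMap.fst ℝ H (E →L[ℝ] H)).comp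
      P.toProd.toContinuousLinearMap).hasFDerivAt.comp_hasDerivAt (0 : ℝ) h2
  have h3 := (h1.clm_apply h2).inner ℂ hu
  simp only [expCurve_zero X, adOdd_one, translate_one, map_one, LinearIsometryEquiv.coe_one,
    id] at h3
  suffices hz : inner ℂ (P.oddAction a (P.tangentPair v)) z
      + inner ℂ (P.oddAction b (P.tangentPair v) + P.oddAction a q) u = 0 by
    rw [hz] at h3
    exact h3
  -- The expression is continuous in (u, z), which lies in the closure of the graph of ρ(X).
  refine P.clGraph_induction (p := fun x => inner ℂ (P.oddAction a (P.tangentPair v)) x.2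
    + inner ℂ (P.oddAction b (P.tangentPair v) + P.oddAction a q) x.1 = 0)
      (isClosed_eq (by fun_prop) (by fun_prop)) (fun w => ?_)
      (P.mem_clGraph_of_hasDerivAt X hu)
  rw [inner_add_left, P.inner_oddAction, P.inner_oddAction, P.inner_oddAction,
    P.inner_rho_even X hq]
  have hb : P.rho b = P.rho (S.lieEquiv X) * P.rho a - P.rho a * P.rho (S.lieEquiv X) := by
    have h := P.rho_bracket 0 1 _ (S.lieEquiv X).2 a a.2
    have hs : superSign 0 1 = 1 := by simp [superSign]
    rwa [hs, one_smul] at h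
  rw [hb]
  simp only [LinearMap.sub_apply, Module.End.mul_apply, Submodule.coe_sub, inner_sub_right]
  change -Complex.I * inner ℂ (v : H) _ + (-Complex.I * (inner ℂ (v : H) _ - inner ℂ (v : H) _) + _)
    = 0
  ring

theorem inner_oddOrbit_expCurve (a : S.alg.part 1) (v : P.smooth)
    (X : GroupLieAlgebra 𝓘(ℝ, E) G) (u : P.B) (t : ℝ) :
    inner ℂ (P.oddOrbit a v (expCurve X t)) (P.π.toHom (expCurve X t) (u : H))
      = inner ℂ (P.oddAction a (P.tangentPair v)) (u : H) := by
  let F : ℝ → ℂ := fun t =>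
    inner ℂ (P.oddOrbit a v (expCurve X t)) (P.π.toHom (expCurve X t) (u : H))
  have hF : ∀ t, HasDerivAt F 0 t := fun t => by
    have hu : HasDerivAt
        (fun s => P.π.toHom (expCurve X s) (P.π.toHom (expCurve X t) (u : H)))
        (P.π.toHom (expCurve X t) (P.rho (S.lieEquiv X) u : H)) 0 := by
      have h := ((P.π.toHom (expCurve X t)).toContinuousLinearEquiv.toContinuousLinearMap.restrictScalars
        ℝ).hasFDerivAt.comp_hasDerivAt (0 : ℝ) (P.hasDerivAt_rho X u)
      refine h.congr_of_eventuallyEq (Eventually.of_forall fun s => ?_)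
      change P.π.toHom (expCurve X s) (P.π.toHom (expCurve X t) (u : H))
        = P.π.toHom (expCurve X t) (P.π.toHom (expCurve X s) (u : H))
      rw [← toHom_mul_apply, ← toHom_mul_apply, ← expCurve_add, ← expCurve_add, add_comm]
    -- The derivative at t is the derivative at 0 for the data translated by exp(tX).
    have h := P.hasDerivAt_inner_oddOrbit_zero (adOdd (expCurve X t) a)
      (P.translate (expCurve X t) v) X hu
    simp only [← oddOrbit_mul, ← toHom_mul_apply, ← expCurve_add] at h
    rw [← sub_self t] at h
    have h' := h.comp_sub_const t t
    simp only [add_sub_cancel] at h'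
    exact h'
  have h := is_const_of_deriv_eq_zero (fun t => (hF t).differentiableAt) (fun t => (hF t).deriv) t 0
  simp only [F, expCurve_zero, oddOrbit_one] at h
  simpa using h

theorem oddOrbit_expCurve (a : S.alg.part 1) (v : P.smooth)
    (X : GroupLieAlgebra 𝓘(ℝ, E) G) (t : ℝ) :
    P.oddOrbit a v (expCurve X t)
      = P.π.toHom (expCurve X t) (P.oddAction a (P.tangentPair v)) := by
  rw [← LinearIsometryEquiv.symm_apply_eq]
  refine P.eq_of_forall_inner_B fun u => ?_
  rw [← P.inner_oddOrbit_expCurve a v X u t, LinearIsometryEquiv.inner_map_eq_flip,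
    LinearIsometryEquiv.symm_symm]

theorem eventually_oddOrbit_eq (a : S.alg.part 1) (v : P.smooth) :
    ∀ᶠ g in 𝓝 (1 : G), P.oddOrbit a v g = P.π.toHom g (P.oddAction a (P.tangentPair v)) := by
  -- Quantifying over all a and v gives stability: right multiplication by exp(tX) replaces them by
  -- their translates.
  let N : Set G := {g | ∀ (a : S.alg.part 1) (v : P.smooth),
    P.oddOrbit a v g = P.π.toHom g (P.oddAction a (P.tangentPair v))}
  have hN : N ∈ 𝓝 (1 : G) := by
    refine mem_nhds_one_of_mul_expCurve_mem (E := E) ?_ ?_ ?_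
    · simp only [N, Set.ofPred_forall]
      exact isClosed_iInter fun a => isClosed_iInter fun v =>
        isClosed_eq (P.contMDiff_oddOrbit a v).continuous (P.π.continuous_orbit _)
    · intro a v
      rw [oddOrbit_one, map_one]
      rfl
    · intro g hg X t a v
      rw [oddOrbit_mul, hg, toHom_mul_apply, ← P.oddOrbit_expCurve a v X t]
      rfl
  exact mem_of_superset hN fun g hg => hg a v

theorem oddAction_mem_smooth (a : S.alg.part 1) (v : P.smooth) :
    P.oddAction a (P.tangentPair v) ∈ P.smooth := by
  set w := P.oddAction a (P.tangentPair v) with hw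
  have h1 : ContMDiffAt 𝓘(ℝ, E) 𝓘(ℝ, H) ∞ (fun g => P.π.toHom g w) 1 :=
    (P.contMDiff_oddOrbit a v 1).congr_of_eventuallyEq
      ((P.eventually_oddOrbit_eq a v).mono fun g hg => hg.symm)
  intro g
  -- Smoothness at 1 moves to g through π(h)w = π(g)π(g⁻¹h)w.
  rw [← inv_mul_cancel g] at h1
  have h2 := ((P.π.toHom g).toContinuousLinearEquiv.toContinuousLinearMap.restrictScalars
    ℝ).contMDiff.contMDiffAt.comp g (h1.comp g (contMDiff_mul_left_infty g⁻¹ g))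
  refine h2.congr_of_eventuallyEq (Eventually.of_forall fun h => ?_)
  change P.π.toHom h w = P.π.toHom g (P.π.toHom (g⁻¹ * h) w)
  rw [← toHom_mul_apply, mul_inv_cancel_left]

theorem exists_mem_smooth_mem_clGraph {i : ZMod 2} {a : 𝔤} (ha : a ∈ S.alg.part i)
    (v : P.smooth) : ∃ y ∈ P.smooth, ((v : H), y) ∈ P.clGraph a := by
  fin_cases i
  · obtain ⟨X, hX⟩ := S.lieEquiv.surjective ⟨a, ha⟩
    refine ⟨_, P.derivedAction_mem_smooth v X, ?_⟩
    have h := P.derivedAction_mem_clGraph v X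
    rwa [hX] at h
  · exact ⟨_, P.oddAction_mem_smooth ⟨a, ha⟩ v, P.oddAction_mem_clGraph ⟨a, ha⟩ (P.tangentPair v)⟩

theorem smooth_le_closure_domain {i : ZMod 2} {a : 𝔤} (ha : a ∈ S.alg.part i) :
    P.smooth ≤ (P.op a).closure.domain := fun v hv =>
  let ⟨_, _, h⟩ := P.exists_mem_smooth_mem_clGraph ha ⟨v, hv⟩
  P.mem_closure_domain_of_mem_clGraph (P.isClosable_op ha) h

theorem closure_apply_mem_smooth {i : ZMod 2} {a : 𝔤} (ha : a ∈ S.alg.part i)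
    (v : (P.op a).closure.domain) (hv : (v : H) ∈ P.smooth) : (P.op a).closure v ∈ P.smooth := by
  obtain ⟨y, hy, h⟩ := P.exists_mem_smooth_mem_clGraph ha ⟨v, hv⟩
  rw [clGraph, (P.isClosable_op ha).graph_closure_eq_closure_graph] at h
  rwa [LinearPMap.mem_graph_snd_inj _ (LinearPMap.mem_graph _ v) h rfl]

end PreRepresentation

end SmoothVectors

/-! ### Homogeneous components and the main theorem -/

theorem BanachLieSuperalgebra.even_mem {𝔤 : Type*} [NormedAddCommGroup 𝔤] [NormedSpace ℝ 𝔤]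
    (A : BanachLieSuperalgebra 𝔤) (x : 𝔤) : A.even x ∈ A.part 0 :=
  Subtype.prop _

theorem BanachLieSuperalgebra.odd_mem {𝔤 : Type*} [NormedAddCommGroup 𝔤] [NormedSpace ℝ 𝔤]
    (A : BanachLieSuperalgebra 𝔤) (x : 𝔤) : A.odd x ∈ A.part 1 :=
  Subtype.prop _

end

/-- For a pre-representation of a Banach--Lie supergroup, `H^∞` lies in the domain of the closure of
`ρ(a)` for every homogeneous `a`, so that each extended operator has domain exactly `H^∞`, and every
extended operator maps `H^∞` into `H^∞`. -/
theorem mainTheorem7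
    {E : Type*} [NormedAddCommGroup E] [NormedSpace ℝ E] [CompleteSpace E]
    {G : Type*} [TopologicalSpace G] [ChartedSpace E G] [Group G] [LieGroup 𝓘(ℝ, E) ω G]
    {𝔤 : Type*} [NormedAddCommGroup 𝔤] [NormedSpace ℝ 𝔤] [CompleteSpace 𝔤]
    {H : Type*} [NormedAddCommGroup H] [InnerProductSpace ℂ H] [CompleteSpace H]
    (S : BanachLieSupergroup E G 𝔤) (Γ : HilbertGrading H) (P : PreRepresentation S Γ) :
    (∀ i, ∀ a ∈ S.alg.part i,
        (P.op a).IsClosable ∧ P.smooth ≤ (P.op a).closure.domain) ∧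
      ∀ x : ℂ ⊗[ℝ] 𝔤, (P.rhoTilde x).domain = P.smooth ∧
        ∀ v : (P.rhoTilde x).domain, P.rhoTilde x v ∈ P.smooth := by
  refine ⟨fun i a ha => ⟨P.isClosable_op ha, P.smooth_le_closure_domain ha⟩, fun x => ?_⟩
  have h0 := fun y => S.alg.even_mem y
  have h1 := fun y => S.alg.odd_mem y
  have hd : (P.rhoTilde x).domain = P.smooth :=
    inf_eq_left.2 (le_inf (le_inf (le_inf (P.smooth_le_closure_domain (h0 _))
      (P.smooth_le_closure_domain (h0 _))) (P.smooth_le_closure_domain (h1 _)))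
      (P.smooth_le_closure_domain (h1 _)))
  refine ⟨hd, fun v => ?_⟩
  have hv : (v : H) ∈ P.smooth := hd ▸ v.2
  exact add_mem (add_mem (add_mem (P.closure_apply_mem_smooth (h0 _) ⟨v, _⟩ hv)
    (Submodule.smul_mem _ _ (P.closure_apply_mem_smooth (h0 _) ⟨v, _⟩ hv)))
    (P.closure_apply_mem_smooth (h1 _) ⟨v, _⟩ hv))
    (Submodule.smul_mem _ _ (P.closure_apply_mem_smooth (h1 _) ⟨v, _⟩ hv))
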